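/- Let $h:\mathbb{C}\to\mathbb{C}$ be an invertible real-affine map, i.e. $h(z)=az+b\bar z+d$ with $a,b,d\in\mathbb{C}$ and $|a|\ne|b|$; let $c\in\mathbb{C}$ and $f(z)=h(z)^2+c$. Then there exist a neighbourhood $U$ of infinity (a connected open set $U\subseteq\mathbb{C}$ containing $\{|z|>R\}$ for some $R$), depending on $h$ and $c$, with $f(U)\subseteq U$, and a quasiconformal map $\psi:U\to\mathbb{C}$ with $\psi(z)\to\infty$ as $z\to\infty$, such that $$h(\psi(z))^2=\psi(f(z))\qquad\text{for all } z\in U.$$ Moreover $\psi$ is asymptotically conformal as $|z|\to\infty$: for every $\varepsilon>0$ there is a neighbourhood $V\subseteq U$ of infinity such that the complex dilatation $\mu_\psi=\psi_{\bar z}/\psi_z$ (formed with weak derivatives, and taken to be $0$ where $\psi_z=\psi_{\bar z}=0$) satisfies $|\mu_\psi(z)|<\varepsilon$ for almost every $z\in V$. Here a map $\psi:U\to\mathbb{C}$ on a domain $U\subseteq\mathbb{C}$ is quasiconformal if it is injective and quasiregular, that is, continuous, in the Sobolev space $W^{1,2}_{\mathrm{loc}}(U)$, and such that for some $K\in[1,\infty)$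 one has $|\psi'(z)|^2\le K J_\psi(z)$ for almost every $z\in U$, where $|\psi'(z)|$ is the operator norm of the weak derivative and $J_\psi(z)$ its Jacobian determinant. -/

import Mathlib

open MeasureTheory Set Filter Bornology
open scoped ContDiff

/-- `D` is a weak (distributional) real derivative of `f` on the open set `U ⊆ ℂ`:
`∫ ∂ᵥφ · f = - ∫ φ · D(v)` for every direction `v` and every real test function
`φ ∈ C_c^∞(U)`. -/
def IsWeakFDerivOn (f : ℂ → ℂ) (D : ℂ → ℂ →L[ℝ] ℂ) (U : Set ℂ) : Prop :=
  ∀ φ : ℂ → ℝ, ContDiff ℝ ∞ φ → HasCompactSupport φ → tsupport φ ⊆ U →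
    ∀ v : ℂ, ∫ z, (fderiv ℝ φ z v) • f z = - ∫ z, φ z • D z v

/-- `f` belongs to the Sobolev space `W^{1,2}_loc(U)`, with weak derivative `D`:
`f` and `D` are square integrable on compact subsets of `U`. -/
structure HasSobolevFDerivOn (f : ℂ → ℂ) (D : ℂ → ℂ →L[ℝ] ℂ) (U : Set ℂ) : Prop where
  memLp_fun : ∀ K : Set ℂ, IsCompact K → K ⊆ U → MemLp f 2 (volume.restrict K)
  memLp_deriv : ∀ K : Set ℂ, IsCompact K → K ⊆ U → MemLp D 2 (volume.restrict K)
  weak : IsWeakFDerivOn f D U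

/-- `f` is quasiregular on the plane domain `U`: it is continuous, lies in `W^{1,2}_loc(U)`, and
for some `K ∈ [1, ∞)` satisfies `|f'(z)|² ≤ K J_f(z)` for almost every `z ∈ U`, where `f'` is the
weak derivative, `|f'(z)|` its operator norm and `J_f` its Jacobian determinant. -/
structure IsQuasiregularOn (f : ℂ → ℂ) (U : Set ℂ) : Prop where
  isOpen : IsOpen U
  isConnected : IsConnected U
  continuousOn : ContinuousOn f U
  distortion : ∃ D : ℂ → ℂ →L[ℝ] ℂ, HasSobolevFDerivOn f D U ∧
    ∃ K : ℝ, 1 ≤ K ∧ ∀ᵐ z, z ∈ U → ‖D z‖ ^ 2 ≤ K * (D z).det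

/-- A quasiconformal map is an injective quasiregular map. -/
structure IsQuasiconformalOn (f : ℂ → ℂ) (U : Set ℂ) : Prop extends IsQuasiregularOn f U where
  injOn : InjOn f U

/-- The Wirtinger derivative `f_z = (f_x - i f_y) / 2`, from the real derivative `A = f'(z)`. -/
noncomputable def wirtingerZ (A : ℂ →L[ℝ] ℂ) : ℂ := (A 1 - Complex.I * A Complex.I) / 2

/-- The Wirtinger derivative `f_{z̄} = (f_x + i f_y) / 2`, from the real derivative `A = f'(z)`. -/
noncomputable def wirtingerZBar (A : ℂ →L[ℝ] ℂ) : ℂ := (A 1 + Complex.I * A Complex.I) / 2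

/-- The complex dilatation `μ_f = f_{z̄} / f_z`, from the real derivative `A = f'(z)`. (The distortion
inequality of a quasiregular map forces `f' = 0` wherever `f_z = 0`; there `μ_f` is set to `0`.) -/
noncomputable def complexDilatation (A : ℂ →L[ℝ] ℂ) : ℂ := wirtingerZBar A / wirtingerZ A

/-- `f`, defined on the neighbourhood `U` of infinity, is asymptotically conformal as `|z| → ∞`:
for every `ε > 0` there is a neighbourhood `V ⊆ U` of infinity with `|μ_f| < ε` almost everywhere
on `V`. The weak derivative is unique up to a null subset of `U`. -/
def IsAsymptoticallyConformalAtInfty (f : ℂ → ℂ) (U : Set ℂ) : Prop :=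
  ∃ D : ℂ → ℂ →L[ℝ] ℂ, HasSobolevFDerivOn f D U ∧
    ∀ ε : ℝ, 0 < ε → ∃ V ∈ cobounded ℂ, V ⊆ U ∧
      ∀ᵐ z, z ∈ V → ‖complexDilatation (D z)‖ < ε

/-! Seek ψ = id + u with u bounded. If A is the linear part of h, the conjugacy equation becomes
h(z) + A u(z) = √(h(z)² + c + u(f(z))), with the root close to h(z); solving for u(z) makes u a
fixed point of `conjugacyStep`. Since |h(z)| grows linearly, taking the root damps a change of
u(f(z)) by a factor O(1/|z|). For large R the step therefore halves sup distances on |z| ≥ R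
(`norm_conjugacyStep_sub_le`), and the iterates of 0 converge.

Regularity comes from a bound that every iterate satisfies and the limit inherits: u is
1/r-Lipschitz on |z| ≥ r (`norm_conjugacyStep_sub_mul_le`). A constant below 1 makes id + u
injective, Lipschitz continuity supplies the weak derivative, and ‖Dψ - id‖ ≤ 1/r almost everywhere
on |z| > r yields both bounded distortion and μ_ψ → 0. -/

/-! ### Estimates for the square root. -/

/-- The branch `√(w² + t) - w` of the increment of the square root which is small compared
with `w`. -/
noncomputable def sqrtShift (w t : ℂ) : ℂ := w * ((1 + t / w ^ 2) ^ (2⁻¹ : ℂ) - 1)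

lemma add_sqrtShift_sq {w : ℂ} (hw : w ≠ 0) (t : ℂ) : (w + sqrtShift w t) ^ 2 = w ^ 2 + t := by
  have h2 : ((1 + t / w ^ 2) ^ (2⁻¹ : ℂ)) ^ 2 = 1 + t / w ^ 2 := by
    simp
  have : w + sqrtShift w t = w * (1 + t / w ^ 2) ^ (2⁻¹ : ℂ) := by
    rw [sqrtShift]; ring
  rw [this, mul_pow, h2]
  field_simp

/-- The principal root has nonnegative real part, so 1 + √(·) has modulus at least 1; no smallness
of t is needed. -/
lemma norm_le_norm_two_mul_add_sqrtShift (w t : ℂ) : ‖w‖ ≤ ‖2 * w + sqrtShift w t‖ := by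
  have : 2 * w + sqrtShift w t = w * (1 + (1 + t / w ^ 2) ^ (2⁻¹ : ℂ)) := by
    rw [sqrtShift]; ring
  rw [this, norm_mul]
  refine le_mul_of_one_le_right (norm_nonneg _) ?_
  refine le_trans ?_ (Complex.re_le_norm _)
  rw [Complex.add_re, Complex.one_re, Complex.cpow_inv_two_re]
  exact le_add_of_nonneg_right (Real.sqrt_nonneg _)

lemma sqrtShift_mul {w : ℂ} (hw : w ≠ 0) (t : ℂ) :
    sqrtShift w t * (2 * w + sqrtShift w t) = t := by
  linear_combination add_sqrtShift_sq hw t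

lemma norm_sqrtShift_mul_le {w : ℂ} (hw : w ≠ 0) (t : ℂ) : ‖sqrtShift w t‖ * ‖w‖ ≤ ‖t‖ := by
  calc ‖sqrtShift w t‖ * ‖w‖ ≤ ‖sqrtShift w t‖ * ‖2 * w + sqrtShift w t‖ := by
        gcongr; exact norm_le_norm_two_mul_add_sqrtShift w t
    _ = ‖t‖ := by rw [← norm_mul, sqrtShift_mul hw]

/-- Subtract the relations p(2w + p) = t and p'(2w' + p') = t'. The resulting term N‖p - p'‖ is
absorbed on the left by `hN`. -/
lemma norm_sqrtShift_sub_mul_le {w w' t t' : ℂ} {N : ℝ} (hw : w ≠ 0) (hw' : w' ≠ 0)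
    (ht : ‖t‖ ≤ N) (hN : 2 * N ≤ ‖w‖ * ‖w'‖) :
    ‖sqrtShift w t - sqrtShift w' t'‖ * (‖w‖ * ‖w'‖) ≤
      2 * ‖t - t'‖ * ‖w‖ + 4 * N * ‖w - w'‖ := by
  set p := sqrtShift w t with hp
  set p' := sqrtShift w' t' with hp'
  have hB := norm_le_norm_two_mul_add_sqrtShift w t
  have hB' := norm_le_norm_two_mul_add_sqrtShift w' t'
  rw [← hp] at hB
  rw [← hp'] at hB'
  have key : (p - p') * (2 * w' + p') =
      (t - t') + t * (2 * (w' - w) + (p' - p)) / (2 * w + p) := by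
    have hb : 2 * w + p ≠ 0 := fun h0 => by
      rw [h0, norm_zero] at hB
      exact hw (norm_le_zero_iff.1 hB)
    field_simp
    linear_combination (2 * w' + p') * sqrtShift_mul hw t - (2 * w + p) * sqrtShift_mul hw' t'
  have hwpos : 0 < ‖w‖ := norm_pos_iff.2 hw
  have hN0 : 0 ≤ N := (norm_nonneg t).trans ht
  have h1 : ‖p - p'‖ * ‖w'‖ ≤ ‖t - t'‖ + N * (2 * ‖w - w'‖ + ‖p - p'‖) / ‖w‖ := by
    calc ‖p - p'‖ * ‖w'‖ ≤ ‖p - p'‖ * ‖2 * w' + p'‖ := by gcongr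
      _ = ‖(t - t') + t * (2 * (w' - w) + (p' - p)) / (2 * w + p)‖ := by rw [← norm_mul, key]
      _ ≤ ‖t - t'‖ + ‖t * (2 * (w' - w) + (p' - p)) / (2 * w + p)‖ := norm_add_le _ _
      _ ≤ ‖t - t'‖ + N * (2 * ‖w - w'‖ + ‖p - p'‖) / ‖w‖ := by
        rw [norm_div, norm_mul]
        gcongr
        refine (norm_add_le _ _).trans (le_of_eq ?_)
        rw [norm_mul, norm_sub_rev w' w, norm_sub_rev p' p, Complex.norm_two]
  have h2 : ‖p - p'‖ * ‖w'‖ * ‖w‖ ≤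
      ‖t - t'‖ * ‖w‖ + N * (2 * ‖w - w'‖ + ‖p - p'‖) := by
    have := mul_le_mul_of_nonneg_right h1 hwpos.le
    rwa [add_mul, div_mul_cancel₀ _ hwpos.ne'] at this
  nlinarith [mul_le_mul_of_nonneg_left hN (norm_nonneg (p - p'))]

/-! ### The fixed-point iteration near infinity. -/

/-- The real-affine map `h` with linear part `A` satisfies two-sided linear bounds on `|z| ≥ R`,
where `R` is so large that the iteration defining the conjugacy between `h² + c` and `h²`
contracts there. -/
structure IsEscapeRadius (A : ℂ ≃ₗ[ℝ] ℂ) (h : ℂ → ℂ) (c : ℂ) (m M R : ℝ) : Prop where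
  m_pos : 0 < m
  M_pos : 0 < M
  map_add : ∀ z v, h (z + v) = h z + A v
  lower_linear : ∀ v, m * ‖v‖ ≤ ‖A v‖
  upper_linear : ∀ v, ‖A v‖ ≤ M * ‖v‖
  lower : ∀ z, R ≤ ‖z‖ → m * ‖z‖ ≤ ‖h z‖
  upper : ∀ z, R ≤ ‖z‖ → ‖h z‖ ≤ M * ‖z‖
  four_le : 4 ≤ R
  perturbation_le : 4 * (‖c‖ + 1) ≤ m ^ 2 * R
  lipschitz_le : 8 * M ^ 2 + 4 * (‖c‖ + 1) * M * m ≤ m ^ 4 * R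

/-- `u` is bounded by `1` on `|z| ≥ R`, and Lipschitz with constant `1 / r` on `|z| ≥ r` for every
`r ≥ R`. -/
structure IsSmallPerturbation (R : ℝ) (u : ℂ → ℂ) : Prop where
  norm_le_one : ∀ z, R ≤ ‖z‖ → ‖u z‖ ≤ 1
  lipschitz : ∀ r, R ≤ r → ∀ z z', r ≤ ‖z‖ → r ≤ ‖z'‖ → ‖u z - u z'‖ * r ≤ ‖z - z'‖

/-- One step of the iteration: `z + conjugacyStep A h c u z` is the solution `y ≈ z` of
`h(y)² = f(z) + u(f(z))`, where `f = h² + c`. -/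
noncomputable def conjugacyStep (A : ℂ ≃ₗ[ℝ] ℂ) (h : ℂ → ℂ) (c : ℂ) (u : ℂ → ℂ) (z : ℂ) : ℂ :=
  A.symm (sqrtShift (h z) (c + u (h z ^ 2 + c)))

namespace IsEscapeRadius

variable {A : ℂ ≃ₗ[ℝ] ℂ} {h : ℂ → ℂ} {c : ℂ} {m M R : ℝ}

lemma pos (H : IsEscapeRadius A h c m M R) : 0 < R := by linarith [H.four_le]

lemma ne_zero (H : IsEscapeRadius A h c m M R) {z : ℂ} (hz : R ≤ ‖z‖) : h z ≠ 0 := by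
  have h1 := H.lower z hz
  have h2 := mul_pos H.m_pos (H.pos.trans_le hz)
  exact norm_pos_iff.1 (h2.trans_le h1)

lemma map_sub (H : IsEscapeRadius A h c m M R) (z z' : ℂ) : h z - h z' = A (z - z') := by
  have := H.map_add z' (z - z')
  rw [add_sub_cancel] at this
  rw [this, add_sub_cancel_left]

lemma sq_le_norm (H : IsEscapeRadius A h c m M R) {r : ℝ} (hr : R ≤ r) {z : ℂ} (hz : r ≤ ‖z‖) :
    m ^ 2 / 2 * r ^ 2 ≤ ‖h z ^ 2 + c‖ := by
  have hR := H.pos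
  have hm := H.m_pos
  have h4 := H.four_le
  have hp := H.perturbation_le
  have h1 : m * r ≤ ‖h z‖ :=
    (mul_le_mul_of_nonneg_left hz hm.le).trans (H.lower z (hr.trans hz))
  have h2 : (m * r) ^ 2 ≤ ‖h z‖ ^ 2 :=
    pow_le_pow_left₀ (mul_nonneg hm.le (hR.le.trans hr)) h1 2
  have h3 : ‖h z‖ ^ 2 - ‖c‖ ≤ ‖h z ^ 2 + c‖ := by
    rw [← norm_pow]
    simpa only [sub_neg_eq_add, norm_neg] using norm_sub_norm_le (h z ^ 2) (-c)
  have h5 : m ^ 2 * R ≤ m ^ 2 * r ^ 2 := by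
    gcongr
    nlinarith
  nlinarith [norm_nonneg c]

lemma le_norm (H : IsEscapeRadius A h c m M R) {z : ℂ} (hz : R ≤ ‖z‖) :
    ‖z‖ ≤ ‖h z ^ 2 + c‖ := by
  refine le_trans ?_ (H.sq_le_norm hz le_rfl)
  have hp := H.perturbation_le
  have hR := H.pos
  have : m ^ 2 * R ≤ m ^ 2 * ‖z‖ := by gcongr
  nlinarith [norm_nonneg c]

lemma norm_symm_le (H : IsEscapeRadius A h c m M R) (v : ℂ) : m * ‖A.symm v‖ ≤ ‖v‖ := by
  simpa using H.lower_linear (A.symm v)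

lemma norm_add_le (H : IsEscapeRadius A h c m M R) {u : ℂ → ℂ} (hu : IsSmallPerturbation R u)
    {z : ℂ} (hz : R ≤ ‖z‖) : ‖c + u (h z ^ 2 + c)‖ ≤ ‖c‖ + 1 :=
  (_root_.norm_add_le _ _).trans <|
    add_le_add le_rfl (hu.norm_le_one _ (hz.trans (H.le_norm hz)))

lemma le_norm_mul_norm (H : IsEscapeRadius A h c m M R) {z z' : ℂ} (hz : R ≤ ‖z‖)
    (hz' : R ≤ ‖z'‖) : 4 * (‖c‖ + 1) ≤ ‖h z‖ * ‖h z'‖ := by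
  have hm := H.m_pos
  have hR := H.pos
  have h1 : (m * R) * (m * R) ≤ ‖h z‖ * ‖h z'‖ := by
    gcongr
    · exact (mul_le_mul_of_nonneg_left hz hm.le).trans (H.lower z hz)
    · exact (mul_le_mul_of_nonneg_left hz' hm.le).trans (H.lower z' hz')
  have h2 : m ^ 2 * R * 1 ≤ m ^ 2 * R * R := by
    gcongr
    linarith [H.four_le]
  nlinarith [H.perturbation_le]

lemma norm_conjugacyStep_sub_le (H : IsEscapeRadius A h c m M R) {u v : ℂ → ℂ}
    (hu : IsSmallPerturbation R u) {z : ℂ} (hz : R ≤ ‖z‖) :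
    ‖conjugacyStep A h c u z - conjugacyStep A h c v z‖ ≤
      ‖u (h z ^ 2 + c) - v (h z ^ 2 + c)‖ / 2 := by
  have hm := H.m_pos
  have h0 := H.ne_zero hz
  have hN := H.le_norm_mul_norm hz hz
  have h1 := norm_sqrtShift_sub_mul_le (t' := c + v (h z ^ 2 + c)) h0 h0 (H.norm_add_le hu hz)
    (by linarith [norm_nonneg c])
  rw [add_sub_add_left_eq_sub, sub_self, norm_zero, mul_zero, add_zero, ← mul_assoc] at h1
  have h2 := le_of_mul_le_mul_right h1 (norm_pos_iff.2 h0)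
  have h3 := H.norm_symm_le (sqrtShift (h z) (c + u (h z ^ 2 + c)) -
    sqrtShift (h z) (c + v (h z ^ 2 + c)))
  rw [_root_.map_sub] at h3
  change m * ‖conjugacyStep A h c u z - conjugacyStep A h c v z‖ ≤ _ at h3
  set Y := ‖conjugacyStep A h c u z - conjugacyStep A h c v z‖
  have hY : 0 ≤ Y := norm_nonneg _
  have h4 : m * R ≤ ‖h z‖ := (mul_le_mul_of_nonneg_left hz hm.le).trans (H.lower z hz)
  have h5 : m * Y * (m * R) ≤ 2 * ‖u (h z ^ 2 + c) - v (h z ^ 2 + c)‖ :=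
    le_trans (mul_le_mul h3 h4 (by have := H.pos; positivity) (norm_nonneg _)) h2
  have h6 : Y * 4 ≤ Y * (m ^ 2 * R) :=
    mul_le_mul_of_nonneg_left (by linarith [H.perturbation_le, norm_nonneg c]) hY
  linarith

lemma norm_conjugacyStep_le_one (H : IsEscapeRadius A h c m M R) {u : ℂ → ℂ}
    (hu : IsSmallPerturbation R u) {z : ℂ} (hz : R ≤ ‖z‖) : ‖conjugacyStep A h c u z‖ ≤ 1 := by
  have hm := H.m_pos
  have hR := H.pos
  have h1 := (norm_sqrtShift_mul_le (H.ne_zero hz) (c + u (h z ^ 2 + c))).trans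
    (H.norm_add_le hu hz)
  have h3 : m * ‖conjugacyStep A h c u z‖ ≤ _ := H.norm_symm_le _
  have h4 : m * R ≤ ‖h z‖ := (mul_le_mul_of_nonneg_left hz hm.le).trans (H.lower z hz)
  have h5 : m * ‖conjugacyStep A h c u z‖ * (m * R) ≤ ‖c‖ + 1 :=
    le_trans (mul_le_mul h3 h4 (by positivity) (norm_nonneg _)) h1
  have h6 := mul_le_mul_of_nonneg_left H.perturbation_le (norm_nonneg (conjugacyStep A h c u z))
  have h7 : 0 < ‖c‖ + 1 := by positivity
  have h8 : (‖c‖ + 1) * ‖conjugacyStep A h c u z‖ ≤ (‖c‖ + 1) * 1 := by nlinarith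
  exact le_of_mul_le_mul_left h8 h7

/-- On |z| ≥ r the map f reaches modulus of order r², where u has Lipschitz constant O(1/r²). This
beats the growth O(‖z'‖) of the difference quotient of f, and the root divides by ‖h z'‖, which
cancels ‖z'‖. What remains is O(1/r²), and `lipschitz_le` trades one factor 1/r for the constant. -/
lemma norm_conjugacyStep_sub_mul_le (H : IsEscapeRadius A h c m M R) {u : ℂ → ℂ}
    (hu : IsSmallPerturbation R u) {r : ℝ} (hr : R ≤ r) {z z' : ℂ} (hz : r ≤ ‖z‖)
    (hzz' : ‖z‖ ≤ ‖z'‖) :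
    ‖conjugacyStep A h c u z - conjugacyStep A h c u z'‖ * r ≤ ‖z - z'‖ := by
  have hm := H.m_pos
  have hM := H.M_pos
  have hR := H.pos
  have hr0 : 0 < r := hR.trans_le hr
  have hz' : r ≤ ‖z'‖ := hz.trans hzz'
  have hs0 : 0 < ‖z'‖ := hr0.trans_le hz'
  have hα : m * r ≤ ‖h z‖ :=
    (mul_le_mul_of_nonneg_left hz hm.le).trans (H.lower z (hr.trans hz))
  have hβ := H.lower z' (hr.trans hz')
  have hα0 : 0 < ‖h z‖ := (mul_pos hm hr0).trans_le hα
  set N := ‖c‖ + 1 with hNdef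
  have hN0 : 0 < N := by positivity
  set d := ‖z - z'‖
  have hd : 0 ≤ d := norm_nonneg _
  set T := ‖u (h z ^ 2 + c) - u (h z' ^ 2 + c)‖ with hT
  have hW : ‖h z - h z'‖ ≤ M * d := by
    rw [H.map_sub]; exact H.upper_linear _
  have hρ : R ≤ m ^ 2 / 2 * r ^ 2 := by
    have h2 : 2 ≤ m ^ 2 * R := by linarith [H.perturbation_le, norm_nonneg c]
    have h3 : 2 * R ≤ m ^ 2 * R * R := by gcongr
    have h4 : m ^ 2 * R * R ≤ m ^ 2 * r * r := by gcongr
    linarith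
  have hTle : T * (m ^ 2 / 2 * r ^ 2) ≤ M * d * (2 * (M * ‖z'‖)) := by
    refine (hu.lipschitz _ hρ _ _ (H.sq_le_norm hr hz) (H.sq_le_norm hr hz')).trans ?_
    have : h z ^ 2 + c - (h z' ^ 2 + c) = (h z - h z') * (h z + h z') := by ring
    rw [this, norm_mul]
    gcongr
    refine (_root_.norm_add_le _ _).trans ?_
    have h1 := H.upper z (hr.trans hz)
    have h2 := H.upper z' (hr.trans hz')
    have h3 : M * ‖z‖ ≤ M * ‖z'‖ := by gcongr
    linarith
  have hX := norm_sqrtShift_sub_mul_le (t' := c + u (h z' ^ 2 + c)) (H.ne_zero (hr.trans hz))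
    (H.ne_zero (hr.trans hz')) (H.norm_add_le hu (hr.trans hz))
    (by linarith [H.le_norm_mul_norm (hr.trans hz) (hr.trans hz')])
  rw [add_sub_add_left_eq_sub, ← hNdef, ← hT] at hX
  have hY := H.norm_symm_le (sqrtShift (h z) (c + u (h z ^ 2 + c)) -
    sqrtShift (h z') (c + u (h z' ^ 2 + c)))
  rw [_root_.map_sub] at hY
  change m * ‖conjugacyStep A h c u z - conjugacyStep A h c u z'‖ ≤ _ at hY
  set X := ‖sqrtShift (h z) (c + u (h z ^ 2 + c)) - sqrtShift (h z') (c + u (h z' ^ 2 + c))‖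
  set Y := ‖conjugacyStep A h c u z - conjugacyStep A h c u z'‖
  have hX0 : 0 ≤ X := norm_nonneg _
  have h1 : X * (m * ‖z'‖) ≤ 2 * T + 4 * N * (M * d) / (m * r) := by
    have e1 : X * ‖h z'‖ ≤ 2 * T + 4 * N * ‖h z - h z'‖ / ‖h z‖ := by
      rw [← sub_le_iff_le_add', le_div_iff₀ hα0]
      linarith
    calc X * (m * ‖z'‖) ≤ X * ‖h z'‖ := by gcongr
      _ ≤ _ := e1
      _ ≤ _ := by gcongr
  have h2 : X * (m * ‖z'‖) * (m ^ 2 * r ^ 2) ≤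
      2 * T * (m ^ 2 * r ^ 2) + 4 * N * (M * d) * (m * r) := by
    refine (mul_le_mul_of_nonneg_right h1 (by positivity)).trans (le_of_eq ?_)
    field_simp
  have h3 : 4 * N * (M * d) * (m * r) ≤ 4 * N * (M * d) * (m * ‖z'‖) := by gcongr
  have h4 : X * m ^ 3 * r ^ 2 * ‖z'‖ ≤ (8 * M ^ 2 + 4 * N * M * m) * d * ‖z'‖ := by
    nlinarith
  have h5 : X * m ^ 3 * r ^ 2 ≤ m ^ 4 * r * d := by
    refine (le_of_mul_le_mul_right h4 hs0).trans ?_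
    refine mul_le_mul_of_nonneg_right (H.lipschitz_le.trans ?_) hd
    gcongr
  have h6 : m * Y * (m ^ 3 * r ^ 2) ≤ X * (m ^ 3 * r ^ 2) := by gcongr
  have h7 : (m ^ 4 * r) * (Y * r) ≤ (m ^ 4 * r) * d := by linarith
  exact le_of_mul_le_mul_left h7 (by positivity)

lemma isSmallPerturbation_conjugacyStep (H : IsEscapeRadius A h c m M R) {u : ℂ → ℂ}
    (hu : IsSmallPerturbation R u) : IsSmallPerturbation R (conjugacyStep A h c u) where
  norm_le_one _ hz := H.norm_conjugacyStep_le_one hu hz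
  lipschitz r hr z z' hz hz' := by
    rcases le_total ‖z‖ ‖z'‖ with hle | hle
    · exact H.norm_conjugacyStep_sub_mul_le hu hr hz hle
    · rw [norm_sub_rev, norm_sub_rev z]
      exact H.norm_conjugacyStep_sub_mul_le hu hr hz' hle

/-- The conjugacy `id + u` between `h² + c` and `h²` on `|z| ≥ R`. -/
lemma exists_conjugacy (H : IsEscapeRadius A h c m M R) :
    ∃ u : ℂ → ℂ, IsSmallPerturbation R u ∧ ∀ z, R ≤ ‖z‖ →
      h (z + u z) ^ 2 = h z ^ 2 + c + u (h z ^ 2 + c) := by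
  set F : ℕ → ℂ → ℂ := fun n => (conjugacyStep A h c)^[n] 0 with hF
  have hsucc : ∀ n, F (n + 1) = conjugacyStep A h c (F n) := fun n =>
    Function.iterate_succ_apply' _ _ _
  have hsmall : ∀ n, IsSmallPerturbation R (F n) := by
    intro n
    induction n with
    | zero => exact ⟨fun z _ => by simp [hF], fun r _ z z' _ _ => by simp [hF]⟩
    | succ n ih => rw [hsucc]; exact H.isSmallPerturbation_conjugacyStep ih
  have hstep : ∀ n z, R ≤ ‖z‖ → ‖F n z - F (n + 1) z‖ ≤ 1 * (1 / 2) ^ n := by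
    intro n
    induction n with
    | zero =>
      intro z hz
      have := (hsmall 1).norm_le_one z hz
      simpa [hF] using this
    | succ n ih =>
      intro z hz
      rw [hsucc (n + 1), hsucc n]
      refine (H.norm_conjugacyStep_sub_le (hsmall n) hz).trans ?_
      have := ih _ (hz.trans (H.le_norm hz))
      rw [hsucc n] at this
      rw [pow_succ (1 / 2 : ℝ)]
      linarith
  have hlim : ∀ z, ∃ l, R ≤ ‖z‖ → Tendsto (fun n => F n z) atTop (nhds l) := by
    intro z
    by_cases hz : R ≤ ‖z‖
    · have hcauchy : CauchySeq fun n => F n z :=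
        cauchySeq_of_le_geometric (1 / 2) 1 (by norm_num) fun n => by
          rw [dist_eq_norm]; exact hstep n z hz
      obtain ⟨l, hl⟩ := cauchySeq_tendsto_of_complete hcauchy
      exact ⟨l, fun _ => hl⟩
    · exact ⟨0, fun hz' => absurd hz' hz⟩
  choose u hu using hlim
  refine ⟨u, ⟨fun z hz => ?_, fun r hr z z' hz hz' => ?_⟩, fun z hz => ?_⟩
  · exact le_of_tendsto (hu z hz).norm (Eventually.of_forall fun n => (hsmall n).norm_le_one z hz)
  · exact le_of_tendsto
      (((hu z (hr.trans hz)).sub (hu z' (hr.trans hz'))).norm.mul_const r)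
      (Eventually.of_forall fun n => (hsmall n).lipschitz r hr z z' hz hz')
  -- Passing to the limit in the squared equation requires no continuity of the branch of the root.
  · have h1 : Tendsto (fun n => (h z + A (F (n + 1) z)) ^ 2) atTop (nhds ((h z + A (u z)) ^ 2)) :=
      (((LinearMap.continuous_of_finiteDimensional A.toLinearMap).tendsto (u z)).comp
        ((hu z hz).comp (tendsto_add_atTop_nat 1))).const_add (h z) |>.pow 2
    have h2 : Tendsto (fun n => h z ^ 2 + c + F n (h z ^ 2 + c)) atTop
        (nhds (h z ^ 2 + c + u (h z ^ 2 + c))) :=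
      (hu _ (hz.trans (H.le_norm hz))).const_add _
    rw [H.map_add]
    refine tendsto_nhds_unique h1 (h2.congr fun n => ?_)
    rw [hsucc, conjugacyStep, LinearEquiv.apply_symm_apply, add_sqrtShift_sq (H.ne_zero hz),
      add_assoc]

end IsEscapeRadius

/-! ### Existence of an escape radius. -/

lemma exists_isEscapeRadius (h : ℂ →ᵃ[ℝ] ℂ) (hh : Function.Bijective h) (c : ℂ) :
    ∃ (A : ℂ ≃ₗ[ℝ] ℂ) (m M R : ℝ), IsEscapeRadius A h c m M R := by
  let A : ℂ ≃ₗ[ℝ] ℂ := LinearEquiv.ofBijective h.linear (h.linear_bijective_iff.2 hh)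
  let A' : ℂ ≃L[ℝ] ℂ := A.toContinuousLinearEquiv
  have hadd : ∀ z v, h (z + v) = h z + A v := fun z v => by
    have := h.map_vadd z v
    simp only [vadd_eq_add] at this
    rw [add_comm z, this, add_comm]
    rfl
  have hz0 : ∀ z, h z = h 0 + A z := fun z => by simpa using hadd 0 z
  set L := ‖(A'.symm : ℂ →L[ℝ] ℂ)‖ + 1 with hL
  set B := ‖(A' : ℂ →L[ℝ] ℂ)‖ + 1 with hB
  have hL0 : 0 < L := by positivity
  have hB0 : 0 < B := by positivity
  have hlow : ∀ v, L⁻¹ * ‖v‖ ≤ ‖A v‖ := fun v => by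
    rw [inv_mul_le_iff₀ hL0]
    have h1 := (A'.symm : ℂ →L[ℝ] ℂ).le_opNorm (A v)
    have h2 : (A'.symm : ℂ →L[ℝ] ℂ) (A v) = v := A.symm_apply_apply v
    rw [h2] at h1
    nlinarith [norm_nonneg (A v)]
  have hup : ∀ v, ‖A v‖ ≤ B * ‖v‖ := fun v => by
    have h1 : ‖A v‖ ≤ _ := (A' : ℂ →L[ℝ] ℂ).le_opNorm v
    nlinarith [norm_nonneg v]
  -- Halving the lower bound of A leaves room to absorb h(0) for large |z|.
  set m := L⁻¹ / 2 with hm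
  have hm0 : 0 < m := by positivity
  obtain ⟨R, h4, h0, h1, h2, h3⟩ : ∃ R : ℝ, 4 ≤ R ∧ ‖h 0‖ ≤ R ∧ ‖h 0‖ / m ≤ R ∧
      4 * (‖c‖ + 1) / m ^ 2 ≤ R ∧ (8 * (B + 1) ^ 2 + 4 * (‖c‖ + 1) * (B + 1) * m) / m ^ 4 ≤ R :=
    ((eventually_ge_atTop _).and <| (eventually_ge_atTop _).and <| (eventually_ge_atTop _).and <|
      (eventually_ge_atTop _).and (eventually_ge_atTop _)).exists
  refine ⟨A, m, B + 1, R, hm0, by positivity, hadd, fun v => ?_, fun v => ?_, fun z hz => ?_,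
    fun z hz => ?_, h4, ?_, ?_⟩
  · refine le_trans ?_ (hlow v)
    gcongr
    linarith [inv_pos.2 hL0]
  · exact (hup v).trans (by gcongr; linarith)
  · have e1 := hlow z
    have e2 : ‖A z‖ - ‖h 0‖ ≤ ‖h z‖ := by
      rw [hz0 z, add_comm]
      simpa using norm_sub_norm_le (A z) (-h 0)
    have e3 : ‖h 0‖ ≤ ‖z‖ * m := (div_le_iff₀ hm0).1 (h1.trans hz)
    have e4 : L⁻¹ = 2 * m := by rw [hm]; ring
    rw [e4] at e1
    linarith
  · rw [hz0 z]
    linarith [norm_add_le (h 0) (A z), hup z]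
  · rwa [div_le_iff₀' (by positivity)] at h2
  · rwa [div_le_iff₀' (by positivity)] at h3

/-! ### Distortion and dilatation near the identity. -/

lemma ContinuousLinearMap.det_complex (D : ℂ →L[ℝ] ℂ) :
    D.det = (D 1).re * (D Complex.I).im - (D Complex.I).re * (D 1).im := by
  rw [ContinuousLinearMap.det, ← LinearMap.det_toMatrix Complex.basisOneI, Matrix.det_fin_two]
  simp [LinearMap.toMatrix_apply]

lemma norm_sq_le_four_mul_det {D : ℂ →L[ℝ] ℂ}
    (hD : ‖D - ContinuousLinearMap.id ℝ ℂ‖ ≤ 1 / 4) : ‖D‖ ^ 2 ≤ 4 * D.det := by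
  have hnorm : ‖D‖ ≤ 5 / 4 := by
    have := norm_le_norm_add_norm_sub' D (ContinuousLinearMap.id ℝ ℂ)
    linarith [ContinuousLinearMap.norm_id_le (𝕜 := ℝ) (E := ℂ)]
  have h1 : ‖D 1 - 1‖ ≤ 1 / 4 := by
    simpa using (D - ContinuousLinearMap.id ℝ ℂ).le_of_opNorm_le hD 1
  have hI : ‖D Complex.I - Complex.I‖ ≤ 1 / 4 := by
    simpa using (D - ContinuousLinearMap.id ℝ ℂ).le_of_opNorm_le hD Complex.I
  have a1 := abs_le.1 ((Complex.abs_re_le_norm _).trans h1)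
  have a2 := abs_le.1 ((Complex.abs_im_le_norm _).trans h1)
  have a3 := abs_le.1 ((Complex.abs_re_le_norm _).trans hI)
  have a4 := abs_le.1 ((Complex.abs_im_le_norm _).trans hI)
  simp only [Complex.sub_re, Complex.sub_im, Complex.one_re, Complex.one_im, Complex.I_re,
    Complex.I_im, sub_zero] at a1 a2 a3 a4
  have hdet : 1 / 2 ≤ D.det := by
    rw [D.det_complex]
    have e1 : 3 / 4 * (3 / 4) ≤ (D 1).re * (D Complex.I).im :=
      mul_le_mul (by linarith) (by linarith) (by norm_num) (by linarith)
    have e2 : |(D Complex.I).re * (D 1).im| ≤ 1 / 4 * (1 / 4) := by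
      rw [abs_mul]
      exact mul_le_mul (abs_le.2 a3) (abs_le.2 a2) (abs_nonneg _) (by norm_num)
    linarith [(abs_le.1 e2).2]
  nlinarith [norm_nonneg D]

lemma norm_complexDilatation_le {D : ℂ →L[ℝ] ℂ} {δ : ℝ} (hδ : δ ≤ 1 / 2)
    (hD : ‖D - ContinuousLinearMap.id ℝ ℂ‖ ≤ δ) : ‖complexDilatation D‖ ≤ 2 * δ := by
  have h1 : ‖D 1 - 1‖ ≤ δ := by
    simpa using (D - ContinuousLinearMap.id ℝ ℂ).le_of_opNorm_le hD 1
  have hI : ‖Complex.I * (D Complex.I - Complex.I)‖ ≤ δ := by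
    simpa using (D - ContinuousLinearMap.id ℝ ℂ).le_of_opNorm_le hD Complex.I
  have hδ0 : 0 ≤ δ := (norm_nonneg _).trans hD
  have hbar : ‖wirtingerZBar D‖ ≤ δ := by
    have : wirtingerZBar D = ((D 1 - 1) + Complex.I * (D Complex.I - Complex.I)) / 2 := by
      rw [wirtingerZBar, mul_sub, Complex.I_mul_I]; ring
    rw [this, norm_div, Complex.norm_two]
    linarith [norm_add_le (D 1 - 1) (Complex.I * (D Complex.I - Complex.I))]
  have hz : 1 / 2 ≤ ‖wirtingerZ D‖ := by
    have : wirtingerZ D - 1 = ((D 1 - 1) - Complex.I * (D Complex.I - Complex.I)) / 2 := by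
      rw [wirtingerZ, mul_sub, Complex.I_mul_I]; ring
    have h2 : ‖wirtingerZ D - 1‖ ≤ δ := by
      rw [this, norm_div, Complex.norm_two]
      linarith [norm_sub_le (D 1 - 1) (Complex.I * (D Complex.I - Complex.I))]
    have h3 := norm_le_norm_add_norm_sub (wirtingerZ D) 1
    rw [norm_one] at h3
    linarith
  rw [complexDilatation, norm_div, div_le_iff₀ (by linarith)]
  nlinarith

/-! ### Lipschitz maps as Sobolev maps. -/

/-- Rademacher's theorem and integration by parts for real Lipschitz functions, applied to real and
imaginary parts. -/
lemma LipschitzWith.isWeakFDerivOn_fderiv {f : ℂ → ℂ} {C : NNReal} (hf : LipschitzWith C f)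
    (U : Set ℂ) : IsWeakFDerivOn f (fderiv ℝ f) U := by
  intro φ hφ hφc _ v
  obtain ⟨C', hφL⟩ := ContDiff.lipschitzWith_of_hasCompactSupport hφc hφ (by simp)
  have hcomp : ∀ ℓ : ℂ →L[ℝ] ℝ,
      ∫ z, fderiv ℝ φ z v * ℓ (f z) = - ∫ z, φ z * ℓ (fderiv ℝ f z v) := by
    intro ℓ
    have key := (ℓ.lipschitz.comp hf).integral_lineDeriv_mul_eq (μ := volume) hφL hφc v
    have e1 : ∫ z, lineDeriv ℝ (ℓ ∘ f) z v * φ z = ∫ z, φ z * ℓ (fderiv ℝ f z v) := by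
      refine integral_congr_ae ?_
      filter_upwards [hf.ae_differentiableAt (μ := volume)] with z hz
      have := (ℓ.hasFDerivAt.comp z hz.hasFDerivAt).hasLineDerivAt v
      rw [this.lineDeriv, mul_comm]
      rfl
    have e2 : ∫ z, lineDeriv ℝ φ z (-v) * (ℓ ∘ f) z = - ∫ z, fderiv ℝ φ z v * ℓ (f z) := by
      rw [← integral_neg]
      refine integral_congr_ae (Eventually.of_forall fun z => ?_)
      have hd : DifferentiableAt ℝ φ z := hφ.differentiable (by simp) z
      simp only [hd.lineDeriv_eq_fderiv, map_neg, neg_mul, Function.comp_apply]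
    rw [← e1, key, e2, neg_neg]
  have hint1 : Integrable (fun z => fderiv ℝ φ z v • f z) := by
    refine Continuous.integrable_of_hasCompactSupport ?_ ?_
    · exact ((hφ.continuous_fderiv (by simp)).clm_apply continuous_const).smul hf.continuous
    · exact (hφc.fderiv_apply ℝ v).smul_right
  have hint2 : Integrable (fun z => φ z • fderiv ℝ f z v) := by
    have hφi : Integrable φ := hφ.continuous.integrable_of_hasCompactSupport hφc
    refine hφi.smul_bdd (C * ‖v‖)
      (measurable_fderiv_apply_const ℝ f v).aestronglyMeasurable (Eventually.of_forall fun z => ?_)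
    exact (fderiv ℝ f z).le_of_opNorm_le (norm_fderiv_le_of_lipschitz ℝ hf) v
  have hℓ : ∀ ℓ : ℂ →L[ℝ] ℝ,
      ℓ (∫ z, fderiv ℝ φ z v • f z) = ℓ (- ∫ z, φ z • fderiv ℝ f z v) := by
    intro ℓ
    rw [map_neg, ← ℓ.integral_comp_comm hint1, ← ℓ.integral_comp_comm hint2]
    simpa only [map_smul, smul_eq_mul] using hcomp ℓ
  exact Complex.ext (hℓ Complex.reCLM) (hℓ Complex.imCLM)

lemma LipschitzWith.hasSobolevFDerivOn_fderiv {f : ℂ → ℂ} {C : NNReal} (hf : LipschitzWith C f)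
    (U : Set ℂ) : HasSobolevFDerivOn f (fderiv ℝ f) U where
  memLp_fun K hK _ := by
    obtain ⟨B, hB⟩ := hK.exists_bound_of_continuousOn hf.continuous.continuousOn
    have : IsFiniteMeasure (volume.restrict K) := isFiniteMeasure_restrict.2 hK.measure_ne_top
    exact MemLp.of_bound hf.continuous.aestronglyMeasurable B
      (ae_restrict_of_forall_mem hK.measurableSet hB)
  memLp_deriv K hK _ := by
    have : IsFiniteMeasure (volume.restrict K) := isFiniteMeasure_restrict.2 hK.measure_ne_top
    exact MemLp.of_bound (measurable_fderiv ℝ f).aestronglyMeasurable C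
      (Eventually.of_forall fun z => norm_fderiv_le_of_lipschitz ℝ hf)
  weak := hf.isWeakFDerivOn_fderiv U

/-! ### Regularity of id + u near infinity. -/

lemma Complex.isConnected_setOf_lt_norm {R : ℝ} (hR : 0 ≤ R) : IsConnected {z : ℂ | R < ‖z‖} := by
  have himage : {z : ℂ | R < ‖z‖} =
      (fun p : ℝ × ℂ => (p.1 : ℂ) * p.2) '' (Ioi R ×ˢ Metric.sphere (0 : ℂ) 1) := by
    ext z
    simp only [mem_ofPred_eq, mem_image, mem_prod, mem_Ioi, mem_sphere_zero_iff_norm, Prod.exists]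
    constructor
    · intro hz
      have h0 : ‖z‖ ≠ 0 := (hR.trans_lt hz).ne'
      refine ⟨‖z‖, z / ‖z‖, ⟨hz, by simp [h0]⟩, ?_⟩
      exact mul_div_cancel₀ _ (Complex.ofReal_ne_zero.2 h0)
    · rintro ⟨r, w, ⟨hr, hw⟩, rfl⟩
      rw [norm_mul, hw, Complex.norm_real, mul_one]
      exact hr.trans_le (le_abs_self r)
  rw [himage]
  refine (isConnected_Ioi.prod (isConnected_sphere ?_ 0 zero_le_one)).image _ (by fun_prop)
  rw [Complex.rank_real_complex]
  exact Nat.one_lt_ofNat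

lemma setOf_lt_norm_mem_cobounded (R : ℝ) : {z : ℂ | R < ‖z‖} ∈ cobounded ℂ :=
  tendsto_norm_cobounded_atTop.eventually (eventually_gt_atTop R)

/-- Replacing u inside the disc makes id + u globally Lipschitz, as the Sobolev lemmas require. -/
lemma IsSmallPerturbation.exists_lipschitzWith_eqOn {R : ℝ} (hR : 0 < R) {u : ℂ → ℂ}
    (hu : IsSmallPerturbation R u) :
    ∃ v : ℂ → ℂ, (∃ C, LipschitzWith C v) ∧ ∀ z, R ≤ ‖z‖ → u z = v z := by
  have hL : LipschitzOnWith (R⁻¹).toNNReal u {z | R ≤ ‖z‖} := by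
    refine LipschitzOnWith.of_dist_le_mul fun z hz z' hz' => ?_
    rw [Real.coe_toNNReal _ (by positivity), dist_eq_norm, dist_eq_norm, le_inv_mul_iff₀ hR,
      mul_comm]
    exact hu.lipschitz R le_rfl z z' hz hz'
  obtain ⟨v, hv, huv⟩ := hL.extend_finite_dimension
  exact ⟨v, ⟨_, hv⟩, fun z hz => huv hz⟩

namespace IsSmallPerturbation

variable {R : ℝ} {u : ℂ → ℂ}

lemma norm_fderiv_sub_id_le (hu : IsSmallPerturbation R u) (hR : 0 < R) {r : ℝ} (hr : R ≤ r)
    {z : ℂ} (hz : r < ‖z‖) (hd : DifferentiableAt ℝ (fun z => z + u z) z) :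
    ‖fderiv ℝ (fun z => z + u z) z - ContinuousLinearMap.id ℝ ℂ‖ ≤ 1 / r := by
  have hr0 : 0 < r := hR.trans_le hr
  have h1 : HasFDerivAt u
      (fderiv ℝ (fun z => z + u z) z - ContinuousLinearMap.id ℝ ℂ) z := by
    refine (hd.hasFDerivAt.sub (hasFDerivAt_id z)).congr_of_eventuallyEq
      (Eventually.of_forall fun w => ?_)
    simp
  refine h1.le_of_lip' (by positivity) ?_
  filter_upwards [(isOpen_lt continuous_const continuous_norm).mem_nhds hz] with w hw
  rw [one_div, le_inv_mul_iff₀ hr0, mul_comm]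
  exact hu.lipschitz r hr w z (le_of_lt hw) hz.le

lemma isQuasiconformalOn (hu : IsSmallPerturbation R u) (hR : 4 ≤ R) {C : NNReal}
    (hL : LipschitzWith C fun z => z + u z) :
    IsQuasiconformalOn (fun z => z + u z) {z | R < ‖z‖} where
  isOpen := isOpen_lt continuous_const continuous_norm
  isConnected := Complex.isConnected_setOf_lt_norm (by linarith)
  continuousOn := hL.continuous.continuousOn
  distortion := by
    refine ⟨_, hL.hasSobolevFDerivOn_fderiv _, 4, by norm_num, ?_⟩
    filter_upwards [hL.ae_differentiableAt (μ := volume)] with z hd hz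
    refine norm_sq_le_four_mul_det
      ((hu.norm_fderiv_sub_id_le (by linarith) le_rfl hz hd).trans ?_)
    gcongr
  injOn := by
    intro z hz z' hz' heq
    have h1 := hu.lipschitz R le_rfl z z' (le_of_lt hz) (le_of_lt hz')
    have h2 : z - z' = -(u z - u z') := by linear_combination (heq : z + u z = z' + u z')
    rw [h2, norm_neg] at h1
    have h3 : ‖u z - u z'‖ = 0 := by nlinarith [norm_nonneg (u z - u z')]
    rw [norm_eq_zero.1 h3, neg_zero] at h2
    exact sub_eq_zero.1 h2

lemma isAsymptoticallyConformalAtInfty (hu : IsSmallPerturbation R u) (hR : 4 ≤ R) {C : NNReal}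
    (hL : LipschitzWith C fun z => z + u z) :
    IsAsymptoticallyConformalAtInfty (fun z => z + u z) {z | R < ‖z‖} := by
  refine ⟨_, hL.hasSobolevFDerivOn_fderiv _, fun ε hε => ?_⟩
  -- Then 1/r ≤ ε/4, so the dilatation is at most 2/r ≤ ε/2.
  set r := max R (4 / ε)
  have hr : R ≤ r := le_max_left _ _
  have hr0 : 0 < r := by linarith
  refine ⟨{z | r < ‖z‖}, setOf_lt_norm_mem_cobounded r, fun z hz => hr.trans_lt hz, ?_⟩
  filter_upwards [hL.ae_differentiableAt (μ := volume)] with z hd hz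
  have h1 : 1 / r ≤ ε / 4 := by
    rw [div_le_iff₀ hr0, ← div_le_iff₀' (by positivity)]
    rw [one_div_div]
    exact le_max_right R (4 / ε)
  have h2 : 1 / r ≤ 1 / 2 := by
    gcongr
    linarith
  have h3 := norm_complexDilatation_le h2 (hu.norm_fderiv_sub_id_le (by linarith) hr hz hd)
  linarith

lemma tendsto_add_cobounded (hu : IsSmallPerturbation R u) :
    Tendsto (fun z => z + u z) (cobounded ℂ) (cobounded ℂ) := by
  rw [← tendsto_norm_atTop_iff_cobounded]
  refine tendsto_atTop_mono' _ ?_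
    (tendsto_atTop_add_const_right _ (-1) (tendsto_norm_cobounded_atTop (E := ℂ)))
  filter_upwards [setOf_lt_norm_mem_cobounded R] with z hz
  have h1 := hu.norm_le_one z (le_of_lt hz)
  have h2 := norm_sub_norm_le z (-u z)
  rw [norm_neg, sub_neg_eq_add] at h2
  linarith

end IsSmallPerturbation

theorem theorem2p1 (h : ℂ →ᵃ[ℝ] ℂ) (hh : Function.Bijective h) (c : ℂ) :
    ∃ U ∈ Bornology.cobounded ℂ, ∃ ψ : ℂ → ℂ,
      IsQuasiconformalOn ψ U ∧
      Set.MapsTo (fun z => h z ^ 2 + c) U U ∧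
      (∀ z ∈ U, h (ψ z) ^ 2 = ψ (h z ^ 2 + c)) ∧
      Filter.Tendsto ψ (Bornology.cobounded ℂ) (Bornology.cobounded ℂ) ∧
      IsAsymptoticallyConformalAtInfty ψ U := by
  obtain ⟨A, m, M, R, H⟩ := exists_isEscapeRadius h hh c
  obtain ⟨u, hu, hconj⟩ := H.exists_conjugacy
  obtain ⟨v, ⟨C, hvL⟩, huv⟩ := hu.exists_lipschitzWith_eqOn H.pos
  have hv : IsSmallPerturbation R v :=
    ⟨fun z hz => huv z hz ▸ hu.norm_le_one z hz, fun r hr z z' hz hz' => by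
      rw [← huv z (hr.trans hz), ← huv z' (hr.trans hz')]
      exact hu.lipschitz r hr z z' hz hz'⟩
  have hL : LipschitzWith (1 + C) fun z => z + v z := LipschitzWith.id.add hvL
  refine ⟨{z | R < ‖z‖}, setOf_lt_norm_mem_cobounded R, fun z => z + v z,
    hv.isQuasiconformalOn H.four_le hL, fun z hz => ?_, fun z hz => ?_, hv.tendsto_add_cobounded,
    hv.isAsymptoticallyConformalAtInfty H.four_le hL⟩
  · exact lt_of_lt_of_le hz (H.le_norm (le_of_lt hz))
  · have hz' : R ≤ ‖z‖ := le_of_lt hz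
    beta_reduce
    rw [← huv z hz', ← huv _ (hz'.trans (H.le_norm hz'))]
    exact hconj z hz'
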